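/- Let $\mathcal H$ be a complex Hilbert space, and let $W=(W_i,w_i)_{i\in I}$ and $V=(V_i,v_i)_{i\in I}$ be families of closed subspaces of $\mathcal H$ with weights $w_i,v_i>0$. The family $W$ is a Bessel fusion sequence if there is $B<\infty$ with $\sum_{i}w_i^2\|\pi_{W_i}f\|^2\le B\|f\|^2$ for all $f\in\mathcal H$, and a fusion frame if moreover there is $A>0$ with $A\|f\|^2\le\sum_i w_i^2\|\pi_{W_i}f\|^2$ for all $f\in\mathcal H$; here $\pi_{W_i}$ is the orthogonal projection onto $W_i$. For a Bessel fusion sequence $W$, let $T_W:(\sum_{i\in I}\bigoplus W_i)_{\ell^2}\to\mathcal H$, $T_W\{f_i\}=\sum_i w_if_i$, be the synthesis operator and $S_W=T_WT_W^*$. For Bessel fusion sequences $W,V$ and a bounded operator $O$ on $\mathcal H$ put $$\mathcal M^{(W,V)}(O)=T_W^*\,O\,T_V:\Big(\sum_{i\in I}\bigoplus V_i\Big)_{\ell^2}\to\Big(\sum_{i\in I}\bigoplus W_i\Big)_{\ell^2},$$ and, if $W,V$ are fusion frames (so that $S_W,S_V$ are positive and invertible), put $\mathcal M_\otimes^{(W,V)}(O)=\mathcal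 M^{(W,V)}(S_W^{-1/2}\,O\,S_V^{-1/2})$. For $0<p<\infty$, $S_p$ denotes the class of compact operators whose singular values (counted with multiplicity) are $p$-summable. Let $0<p<\infty$ and let $O$ be a bounded operator on $\mathcal H$. (a) Let $W,V$ be Bessel fusion sequences. If $O$ is compact, then $\mathcal M^{(W,V)}(O)$ is compact. If $O\in S_p$, then $\mathcal M^{(W,V)}(O)\in S_p$. (b) Let $W,V$ be fusion frames. Then $O$ is compact if and only if $\mathcal M^{(W,V)}(O)$ is compact, and if and only if $\mathcal M_\otimes^{(W,V)}(O)$ is compact. Likewise, $O\in S_p$ if and only if $\mathcal M^{(W,V)}(O)\in S_p$, and if and only if $\mathcal M_\otimes^{(W,V)}(O)\in S_p$. -/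

import Mathlib

open scoped InnerProductSpace

noncomputable section

/-- A family `(W i, w i)` of closed subspaces of `H` with weights `w i > 0`. -/
structure WeightedSubspaces (I : Type*) (H : Type*) [NormedAddCommGroup H]
    [InnerProductSpace ℂ H] where
  space : I → Submodule ℂ H
  isClosed : ∀ i, IsClosed (space i : Set H)
  weight : I → ℝ
  weight_pos : ∀ i, 0 < weight i

namespace WeightedSubspaces

variable {I : Type*} {H : Type*} [NormedAddCommGroup H] [InnerProductSpace ℂ H]
  [CompleteSpace H]

instance instCompleteSpaceSpace (W : WeightedSubspaces I H) (i : I) :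
    CompleteSpace (W.space i) :=
  (W.isClosed i).completeSpace_coe

/-- `∑ w i ^ 2 * ‖π_{W i} f‖ ^ 2 ≤ B * ‖f‖ ^ 2` for all `f`, the series being convergent. -/
def HasUpperBound (W : WeightedSubspaces I H) (B : ℝ) : Prop :=
  ∀ f : H, Summable (fun i => W.weight i ^ 2 * ‖(W.space i).starProjection f‖ ^ 2) ∧
    ∑' i, W.weight i ^ 2 * ‖(W.space i).starProjection f‖ ^ 2 ≤ B * ‖f‖ ^ 2

/-- Bessel fusion sequences: only the upper bound is required. -/
def IsBessel (W : WeightedSubspaces I H) : Prop :=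
  ∃ B : ℝ, 0 < B ∧ W.HasUpperBound B

/-- Fusion frames, with fusion frame bounds `0 < A ≤ B < ∞`. -/
def IsFusionFrame (W : WeightedSubspaces I H) : Prop :=
  ∃ A B : ℝ, 0 < A ∧ A ≤ B ∧ W.HasUpperBound B ∧
    ∀ f : H, A * ‖f‖ ^ 2 ≤ ∑' i, W.weight i ^ 2 * ‖(W.space i).starProjection f‖ ^ 2

theorem IsFusionFrame.isBessel {W : WeightedSubspaces I H} (hW : W.IsFusionFrame) :
    W.IsBessel := by
  obtain ⟨A, B, hA, hAB, hB, -⟩ := hW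
  exact ⟨B, hA.trans_le hAB, hB⟩

/-- The Hilbert space `(∑ ⊕ W i)_{ℓ²}`. -/
abbrev DirectSum (W : WeightedSubspaces I H) : Type _ :=
  lp (fun i => W.space i) 2

/-- Cauchy–Schwarz estimate for finite partial sums of the synthesis series. -/
theorem HasUpperBound.norm_sum_le {W : WeightedSubspaces I H} {B : ℝ} (hB : 0 < B)
    (hW : W.HasUpperBound B) (f : ∀ i, W.space i) (s : Finset I) :
    ‖∑ i ∈ s, (W.weight i : ℂ) • (f i : H)‖ ≤ √B * √(∑ i ∈ s, ‖f i‖ ^ 2) := by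
  set x : H := ∑ i ∈ s, (W.weight i : ℂ) • (f i : H) with hx
  have h1 : ‖x‖ ^ 2 ≤ ∑ i ∈ s, (W.weight i * ‖(W.space i).starProjection x‖) * ‖f i‖ := by
    have h2 : ⟪x, x⟫_ℂ =
        ∑ i ∈ s, (W.weight i : ℂ) * ⟪(W.space i).starProjection x, (f i : H)⟫_ℂ := by
      conv_lhs => rw [hx, inner_sum, ← hx]
      refine Finset.sum_congr rfl fun i _ => ?_
      rw [inner_smul_right, Submodule.inner_starProjection_left_eq_right,
        Submodule.starProjection_eq_self_iff.2 (f i).2]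
    have h3 : ‖x‖ ^ 2 = ‖⟪x, x⟫_ℂ‖ := by
      rw [inner_self_eq_norm_sq_to_K]; simp
    rw [h3, h2]
    refine (_root_.norm_sum_le _ _).trans (Finset.sum_le_sum fun i _ => ?_)
    rw [norm_mul, Complex.norm_real, Real.norm_of_nonneg (W.weight_pos i).le, mul_assoc]
    exact mul_le_mul_of_nonneg_left (norm_inner_le_norm _ _) (W.weight_pos i).le
  have h4 : ∑ i ∈ s, (W.weight i * ‖(W.space i).starProjection x‖) ^ 2 ≤ B * ‖x‖ ^ 2 := by
    refine le_trans ?_ (hW x).2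
    simp only [mul_pow]
    exact (hW x).1.sum_le_tsum s fun i _ => by positivity
  have h5 := h1.trans (Real.sum_mul_le_sqrt_mul_sqrt s _ _)
  have h6 : ‖x‖ * ‖x‖ ≤ ‖x‖ * (√B * √(∑ i ∈ s, ‖f i‖ ^ 2)) := by
    rw [← sq]
    refine h5.trans ?_
    have : √(∑ i ∈ s, (W.weight i * ‖(W.space i).starProjection x‖) ^ 2) ≤ √B * ‖x‖ := by
      refine (Real.sqrt_le_sqrt h4).trans ?_
      rw [Real.sqrt_mul hB.le, Real.sqrt_sq (norm_nonneg x)]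
    calc _ ≤ (√B * ‖x‖) * √(∑ i ∈ s, ‖f i‖ ^ 2) :=
          mul_le_mul_of_nonneg_right this (Real.sqrt_nonneg _)
      _ = _ := by ring
  rcases (norm_nonneg x).eq_or_lt with h | h
  · rw [← h]; positivity
  · exact le_of_mul_le_mul_left h6 h

set_option linter.unusedSectionVars false in
theorem summable_norm_sq (W : WeightedSubspaces I H) (f : W.DirectSum) :
    Summable fun i => ‖f i‖ ^ 2 := by
  simpa using (lp.memℓp f).summable (by norm_num)

theorem IsBessel.summable {W : WeightedSubspaces I H} (hW : W.IsBessel) (f : W.DirectSum) :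
    Summable fun i => (W.weight i : ℂ) • (f i : H) := by
  obtain ⟨B, hB, hW⟩ := hW
  rw [summable_iff_vanishing_norm]
  intro ε hε
  obtain ⟨s, hs⟩ := summable_iff_vanishing_norm.1 (W.summable_norm_sq f) (ε ^ 2 / B)
    (by positivity)
  refine ⟨s, fun t ht => (hW.norm_sum_le hB (fun i => f i) t).trans_lt ?_⟩
  have h := (le_abs_self _).trans_lt (hs t ht)
  rw [← Real.sqrt_mul hB.le, ← Real.sqrt_sq hε.le]
  refine Real.sqrt_lt_sqrt (by positivity) ?_
  rwa [lt_div_iff₀ hB, mul_comm] at h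

theorem IsBessel.exists_bound {W : WeightedSubspaces I H} (hW : W.IsBessel) :
    ∃ C : ℝ, ∀ f : W.DirectSum, ‖∑' i, (W.weight i : ℂ) • (f i : H)‖ ≤ C * ‖f‖ := by
  obtain ⟨B, hB, hB'⟩ := id hW
  refine ⟨√B, fun f => le_of_tendsto (hW.summable f).hasSum.norm (.of_forall fun s => ?_)⟩
  refine (hB'.norm_sum_le hB (fun i => f i) s).trans
    (mul_le_mul_of_nonneg_left ?_ (Real.sqrt_nonneg _))
  refine Real.sqrt_le_iff.2 ⟨norm_nonneg f, ?_⟩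
  simpa using lp.sum_rpow_le_norm_rpow (p := 2) (by norm_num) f s

/-- The synthesis operator `T_W {f i} = ∑ w i • f i` of a Bessel fusion sequence. -/
def synthesis (W : WeightedSubspaces I H) (hW : W.IsBessel) : W.DirectSum →L[ℂ] H :=
  LinearMap.mkContinuousOfExistsBound
    { toFun := fun f => ∑' i, (W.weight i : ℂ) • (f i : H)
      map_add' := fun f g => by
        rw [← (hW.summable f).tsum_add (hW.summable g)]
        simp
      map_smul' := fun c f => by
        rw [RingHom.id_apply, ← (hW.summable f).tsum_const_smul c]
        refine tsum_congr fun i => ?_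
        simp [smul_comm c] }
    hW.exists_bound

/-- The analysis operator `T_W^*`. -/
def analysis (W : WeightedSubspaces I H) (hW : W.IsBessel) : H →L[ℂ] W.DirectSum :=
  ContinuousLinearMap.adjoint (W.synthesis hW)

/-- The fusion frame operator `S_W = T_W T_W^*`. -/
def frameOperator (W : WeightedSubspaces I H) (hW : W.IsBessel) : H →L[ℂ] H :=
  W.synthesis hW ∘L W.analysis hW

/-- `S_W^{-1/2}`, through the continuous functional calculus; for a fusion frame `S_W` is
positive and invertible. -/
def frameOperatorInvSqrt (W : WeightedSubspaces I H) (hW : W.IsFusionFrame) : H →L[ℂ] H :=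
  W.frameOperator hW.isBessel ^ (-(1 / 2) : ℝ)

end WeightedSubspaces

/-- The tensor product of operators: `(S ⊗ T) O = S ∘ O ∘ T^*`. -/
def tensorOp {H₁ H₂ H₃ H₄ : Type*}
    [NormedAddCommGroup H₁] [InnerProductSpace ℂ H₁] [CompleteSpace H₁]
    [NormedAddCommGroup H₂] [InnerProductSpace ℂ H₂] [CompleteSpace H₂]
    [NormedAddCommGroup H₃] [InnerProductSpace ℂ H₃]
    [NormedAddCommGroup H₄] [InnerProductSpace ℂ H₄]
    (S : H₃ →L[ℂ] H₄) (T : H₁ →L[ℂ] H₂) (O : H₁ →L[ℂ] H₃) : H₂ →L[ℂ] H₄ :=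
  S ∘L O ∘L ContinuousLinearMap.adjoint T

section MatrixRepresentation

variable {I : Type*} {H : Type*} [NormedAddCommGroup H] [InnerProductSpace ℂ H]
  [CompleteSpace H]

/-- `M^{(W,V)}(O) = (T_W^* ⊗ T_V^*)(O)`. -/
def matrixRep (W V : WeightedSubspaces I H) (hW : W.IsBessel) (hV : V.IsBessel)
    (O : H →L[ℂ] H) : V.DirectSum →L[ℂ] W.DirectSum :=
  tensorOp (W.analysis hW) (V.analysis hV) O

/-- `M_⊗^{(W,V)}(O) = M^{(W,V)}((S_W^{-1/2} ⊗ S_V^{-1/2})(O))`. -/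
def matrixRepTensor (W V : WeightedSubspaces I H) (hW : W.IsFusionFrame)
    (hV : V.IsFusionFrame) (O : H →L[ℂ] H) : V.DirectSum →L[ℂ] W.DirectSum :=
  matrixRep W V hW.isBessel hV.isBessel
    (tensorOp (W.frameOperatorInvSqrt hW) (V.frameOperatorInvSqrt hV) O)

theorem analysis_apply (W : WeightedSubspaces I H) (hW : W.IsBessel) (f : H) (i : I) :
    W.analysis hW f i = (W.weight i : ℂ) • (W.space i).orthogonalProjectionOnto f := by
  classical
  refine ext_inner_left ℂ fun v => ?_
  have h : W.synthesis hW (lp.single 2 i v) = (W.weight i : ℂ) • (v : H) := by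
    change ∑' j, (W.weight j : ℂ) • ((lp.single 2 i v : W.DirectSum) j : H) = _
    rw [tsum_eq_single i]
    · simp
    · intro j hj
      simp [hj]
  refine (lp.inner_single_left (𝕜 := ℂ) (G := fun i => W.space i) i v (W.analysis hW f)).symm.trans ?_
  rw [WeightedSubspaces.analysis, ContinuousLinearMap.adjoint_inner_right, h, inner_smul_left,
    inner_smul_right]
  simp

/-- `M^{(W,V)}(O)` is the block matrix with entries `w j * v i * π_{W j} O π_{V i}`. -/
theorem matrixRep_hasSum (W V : WeightedSubspaces I H) (hW : W.IsBessel) (hV : V.IsBessel)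
    (O : H →L[ℂ] H) (f : V.DirectSum) (j : I) :
    HasSum (fun i => ((W.weight j : ℂ) * (V.weight i : ℂ)) •
      (W.space j).orthogonalProjectionOnto (O (f i : H))) (matrixRep W V hW hV O f j) := by
  have h : HasSum (fun i => (V.weight i : ℂ) • (f i : H)) (V.synthesis hV f) :=
    (hV.summable f).hasSum
  have h2 := ((W.space j).orthogonalProjectionOnto ∘L O).hasSum h
  have h3 := h2.const_smul (W.weight j : ℂ)
  have h4 : matrixRep W V hW hV O f j =
      (W.weight j : ℂ) • ((W.space j).orthogonalProjectionOnto ∘L O) (V.synthesis hV f) := by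
    simp [matrixRep, tensorOp, analysis_apply, WeightedSubspaces.analysis.eq_1 V]
  rw [h4]
  convert h3 using 2 with i
  rw [mul_smul, map_smul]
  rfl

end MatrixRepresentation

section Schatten

variable {E F : Type*} [NormedAddCommGroup E] [InnerProductSpace ℂ E] [CompleteSpace E]
  [NormedAddCommGroup F] [InnerProductSpace ℂ F] [CompleteSpace F]

/-- The eigenspace of `T^* T` for the eigenvalue `s ^ 2`. -/
def singularSpace (T : E →L[ℂ] F) (s : ℝ) : Submodule ℂ E :=
  Module.End.eigenspace
    ((ContinuousLinearMap.adjoint T ∘L T : E →L[ℂ] E) : E →ₗ[ℂ] E) ((s : ℂ) ^ 2)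

/-- Index set of the nonzero singular values of `T`: each `s > 0` such that `s ^ 2` is an
eigenvalue of `T^* T` is repeated as often as the dimension of the eigenspace. For compact `T`
these eigenspaces are finite-dimensional. -/
def SingularIndex (T : E →L[ℂ] F) : Type :=
  Σ s : {s : ℝ // 0 < s ∧ singularSpace T s ≠ ⊥}, Fin (Module.finrank ℂ (singularSpace T s))

/-- The family of nonzero singular values of `T`, with multiplicities. -/
def nonzeroSingularValue (T : E →L[ℂ] F) (n : SingularIndex T) : ℝ :=
  n.1

/-- `T` is in the Schatten class `S_p(E, F)`, `0 < p < ∞`: it is compact and its singular values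
form a `p`-summable family. -/
def IsSchatten (p : ℝ) (T : E →L[ℂ] F) : Prop :=
  IsCompactOperator T ∧ Summable fun n : SingularIndex T => nonzeroSingularValue T n ^ p

end Schatten

end

open scoped InnerProductSpace

noncomputable section

/-! Since `matrixRep` is `O` composed with bounded operators on both sides, and so is
`matrixRepTensor`, part (a) and the forward halves of (b) only need compact operators and `S_p` to
be two-sided ideals. For fusion frames the lower bound makes `S_W` and `S_V` invertible, so `O =
S_W⁻¹ T_W M(O) T_V^* S_V⁻¹` is in turn a sandwich of `M(O)`, and the same ideal property gives the
converses. The factors `S_W^{-1/2}`, `S_V^{-1/2}` are invertible and are cancelled likewise.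

For `S_p`, the ideal property comes from counting singular values
(`encard_setOf_le_nonzeroSingularValue_comp_le`). The number of them that are at least `t` is the
dimension of the span of the eigenvectors of `T^* T` with eigenvalue at least `t ^ 2`. There `T` is
bounded below by `t`, and on the orthogonal complement it is bounded above by `t`. Hence for `c >
‖A‖ ‖B‖` the count for `A T B` at `t` is at most that for `T` at `t / c`, and the layer-cake formula
turns this into `p`-summability for every `p > 0`. -/

open Module.End in
/-- Decomposition of the energy of a vector in a sum of eigenspaces of a symmetric operator. -/
theorem LinearMap.IsSymmetric.exists_eigen_decomposition {E : Type*} [NormedAddCommGroup E]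
    [InnerProductSpace ℂ E] {S : E →ₗ[ℂ] E} (hS : S.IsSymmetric) (P : ℂ → Prop) {x : E}
    (hx : x ∈ ⨆ μ : {μ : ℂ // P μ}, eigenspace S (μ : ℂ)) :
    ∃ (s : Finset {μ : ℂ // P μ}) (v : {μ : ℂ // P μ} → E),
      ‖x‖ ^ 2 = ∑ μ ∈ s, ‖v μ‖ ^ 2 ∧
      RCLike.re ⟪x, S x⟫_ℂ = ∑ μ ∈ s, (μ : ℂ).re * ‖v μ‖ ^ 2 := by
  obtain ⟨f, hf, rfl⟩ := (Submodule.mem_iSup_iff_exists_finsupp _ _).1 hx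
  have hV : OrthogonalFamily ℂ (fun μ : {μ : ℂ // P μ} => eigenspace S (μ : ℂ))
      fun μ => (eigenspace S (μ : ℂ)).subtypeₗᵢ :=
    hS.orthogonalFamily_eigenspaces.comp Subtype.coe_injective
  refine ⟨f.support, f, hV.norm_sum (fun μ => ⟨f μ, hf μ⟩) f.support, ?_⟩
  have h1 := hV.inner_sum (fun μ => ⟨f μ, hf μ⟩) (fun μ => (μ : ℂ) • ⟨f μ, hf μ⟩) f.support
  have h2 : S (f.sum fun _ x => x) = ∑ μ ∈ f.support, (μ : ℂ) • f μ := by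
    rw [Finsupp.sum, map_sum]
    exact Finset.sum_congr rfl fun μ _ => mem_eigenspace_iff.1 (hf μ)
  rw [h2]
  refine (congrArg RCLike.re h1).trans ?_
  rw [map_sum]
  refine Finset.sum_congr rfl fun μ _ => ?_
  rw [inner_smul_right, inner_self_eq_norm_sq_to_K]
  simp [← Complex.ofReal_pow]

/-- A closed subspace on which a compact operator is bounded below is finite-dimensional. -/
theorem IsCompactOperator.finiteDimensional_of_bddBelow {E F : Type*} [NormedAddCommGroup E]
    [NormedSpace ℂ E] [CompleteSpace E] [NormedAddCommGroup F] [NormedSpace ℂ F]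
    {T : E →L[ℂ] F} (hT : IsCompactOperator T) {t : ℝ} (ht : 0 < t) (K : Submodule ℂ E)
    (hK : IsClosed (K : Set E)) (h : ∀ x ∈ K, t * ‖x‖ ≤ ‖T x‖) : FiniteDimensional ℂ K := by
  have := hK.completeSpace_coe
  let R : K →L[ℂ] F := T ∘L K.subtypeL
  have hR : IsCompactOperator R := hT.comp_clm K.subtypeL
  have hanti : AntilipschitzWith (Real.toNNReal t⁻¹) R := by
    refine AddMonoidHomClass.antilipschitz_of_bound R fun x => ?_
    rw [Real.coe_toNNReal _ (by positivity), inv_mul_eq_div, le_div_iff₀ ht, mul_comm]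
    exact h x x.2
  have hemb := hanti.isClosedEmbedding R.uniformContinuous
  obtain ⟨C, hC, hC0⟩ := hR
  -- The preimage of `C` is a compact neighbourhood of `0` in `K`, so Riesz's theorem applies.
  have : LocallyCompactSpace K :=
    (hemb.isCompact_preimage hC).locallyCompactSpace_of_mem_nhds_of_addGroup hC0
  exact FiniteDimensional.of_locallyCompactSpace ℂ

theorem IsCompactOperator.clm_comp_clm {E F E' F' : Type*}
    [NormedAddCommGroup E] [NormedSpace ℂ E] [NormedAddCommGroup F] [NormedSpace ℂ F]
    [NormedAddCommGroup E'] [NormedSpace ℂ E'] [NormedAddCommGroup F'] [NormedSpace ℂ F']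
    {T : E →L[ℂ] F} (hT : IsCompactOperator T) (A : F →L[ℂ] F') (B : E' →L[ℂ] E) :
    IsCompactOperator (A ∘L T ∘L B) :=
  (hT.comp_clm B).clm_comp A

open MeasureTheory in
/-- A nonnegative family whose counting function is dominated by that of a rescaled `p`-summable
family is `p`-summable. -/
theorem summable_rpow_of_encard_le {α β : Type*} {f : α → ℝ} {g : β → ℝ} {p c : ℝ} (hp : 0 < p)
    (hc : 0 < c) (hf : ∀ a, 0 ≤ f a) (hg : ∀ b, 0 ≤ g b)
    (h : ∀ t, 0 < t → {a | t ≤ f a}.encard ≤ {b | t / c ≤ g b}.encard)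
    (hs : Summable fun b => g b ^ p) : Summable fun a => f a ^ p := by
  let _ : MeasurableSpace α := ⊤
  let _ : MeasurableSpace β := ⊤
  have hs' : Summable fun b => (c * g b) ^ p := by
    simpa only [Real.mul_rpow hc.le (hg _)] using hs.mul_left (c ^ p)
  have hle : ∑' a, ENNReal.ofReal (f a ^ p) ≤ ∑' b, ENNReal.ofReal ((c * g b) ^ p) := by
    -- Layer cake for counting measure: both sums become integrals of the counting functions against
    -- `t ^ (p - 1)`.
    rw [← lintegral_count, ← lintegral_count,
      lintegral_rpow_eq_lintegral_meas_le_mul _ (.of_forall hf) (measurable_from_top.aemeasurable) hp,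
      lintegral_rpow_eq_lintegral_meas_le_mul _ (.of_forall fun b => mul_nonneg hc.le (hg b))
        (measurable_from_top.aemeasurable) hp]
    refine mul_le_mul_right (setLIntegral_mono' measurableSet_Ioi fun t ht => ?_) _
    refine mul_le_mul_left ?_ _
    rw [Measure.count_apply (MeasurableSpace.measurableSet_top),
      Measure.count_apply (MeasurableSpace.measurableSet_top)]
    have h1 : {b | t ≤ c * g b} = {b | t / c ≤ g b} := by
      ext b
      simp only [Set.mem_ofPred_eq, div_le_iff₀' hc]
    rw [h1]
    exact_mod_cast h t ht
  have hne := ne_top_of_le_ne_top hs'.tsum_ofReal_ne_top hle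
  refine (ENNReal.summable_toReal hne).congr fun a => ?_
  exact ENNReal.toReal_ofReal (Real.rpow_nonneg (hf a) p)

/-! ### Singular values and the ideal property of the Schatten classes -/

section Schatten

variable {E F : Type*} [NormedAddCommGroup E] [InnerProductSpace ℂ E] [CompleteSpace E]
  [NormedAddCommGroup F] [InnerProductSpace ℂ F] [CompleteSpace F]

/-- The positive operator `T^* T`. -/
abbrev gram (T : E →L[ℂ] F) : E →L[ℂ] E := ContinuousLinearMap.adjoint T ∘L T

theorem gram_isSymmetric (T : E →L[ℂ] F) : (gram T : E →ₗ[ℂ] E).IsSymmetric :=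
  (ContinuousLinearMap.isPositive_adjoint_comp_self T).isSymmetric

theorem gram_isCompactOperator {T : E →L[ℂ] F} (hT : IsCompactOperator T) :
    IsCompactOperator (gram T) :=
  hT.clm_comp (ContinuousLinearMap.adjoint T)

theorem re_inner_gram (T : E →L[ℂ] F) (x : E) :
    RCLike.re ⟪x, (gram T : E →ₗ[ℂ] E) x⟫_ℂ = ‖T x‖ ^ 2 := by
  change RCLike.re ⟪x, ContinuousLinearMap.adjoint T (T x)⟫_ℂ = _
  rw [ContinuousLinearMap.adjoint_inner_right, inner_self_eq_norm_sq]

/-- The span of the eigenvectors of `T^* T` with eigenvalue at least `t ^ 2`. -/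
def upperSingularSpace (T : E →L[ℂ] F) (t : ℝ) : Submodule ℂ E :=
  ⨆ μ : {μ : ℂ // t ^ 2 ≤ μ.re}, Module.End.eigenspace (gram T : E →ₗ[ℂ] E) (μ : ℂ)

theorem le_norm_apply_of_mem_upperSingularSpace (T : E →L[ℂ] F) {t : ℝ} {x : E}
    (hx : x ∈ upperSingularSpace T t) : t * ‖x‖ ≤ ‖T x‖ := by
  obtain ⟨s, v, h1, h2⟩ :=
    (gram_isSymmetric T).exists_eigen_decomposition (fun μ : ℂ => t ^ 2 ≤ μ.re) hx
  refine le_of_sq_le_sq ?_ (norm_nonneg _)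
  rw [← re_inner_gram, h2, mul_pow, h1, Finset.mul_sum]
  gcongr with μ
  exact μ.2

theorem finiteDimensional_upperSingularSpace {T : E →L[ℂ] F} (hT : IsCompactOperator T) {t : ℝ}
    (ht : 0 < t) : FiniteDimensional ℂ (upperSingularSpace T t) := by
  have : FiniteDimensional ℂ (upperSingularSpace T t).topologicalClosure := by
    refine hT.finiteDimensional_of_bddBelow ht _ (Submodule.isClosed_topologicalClosure _) ?_
    intro x hx
    refine closure_minimal (s := (upperSingularSpace T t : Set E))
      (t := {x | t * ‖x‖ ≤ ‖T x‖})
      (fun x hx => le_norm_apply_of_mem_upperSingularSpace T hx) ?_ hx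
    exact isClosed_le (by fun_prop) (by fun_prop)
  exact Submodule.finiteDimensional_of_le (Submodule.le_topologicalClosure _)

theorem norm_apply_le_of_mem_upperSingularSpace_orthogonal {T : E →L[ℂ] F}
    (hT : IsCompactOperator T) {t : ℝ} (ht : 0 < t) {x : E}
    (hx : x ∈ (upperSingularSpace T t)ᗮ) : ‖T x‖ ≤ t * ‖x‖ := by
  set L : Submodule ℂ E :=
    ⨆ μ : {μ : ℂ // μ.re < t ^ 2}, Module.End.eigenspace (gram T : E →ₗ[ℂ] E) (μ : ℂ) with hL
  have hLT : ∀ y ∈ L, ‖T y‖ ≤ t * ‖y‖ := by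
    intro y hy
    obtain ⟨s, v, h1, h2⟩ :=
      (gram_isSymmetric T).exists_eigen_decomposition (fun μ : ℂ => μ.re < t ^ 2) hy
    refine le_of_sq_le_sq ?_ (by positivity)
    rw [← re_inner_gram, h2, mul_pow, h1, Finset.mul_sum]
    gcongr with μ
    exact μ.2.le
  have hLc : ∀ y ∈ L.topologicalClosure, ‖T y‖ ≤ t * ‖y‖ := fun y hy =>
    closure_minimal (s := (L : Set E)) (t := {x | ‖T x‖ ≤ t * ‖x‖}) hLT
      (isClosed_le (by fun_prop) (by fun_prop)) hy
  have hortho : L ≤ (upperSingularSpace T t)ᗮ := by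
    rw [hL, upperSingularSpace, ← Submodule.iInf_orthogonal]
    refine iSup_le fun μ => le_iInf fun ν => ?_
    refine Submodule.isOrtho_iff_le.1 ?_
    refine (gram_isSymmetric T).orthogonalFamily_eigenspaces.isOrtho ?_
    intro h
    exact absurd μ.2 (not_lt.2 (h ▸ ν.2))
  have := (Submodule.isClosed_topologicalClosure L).completeSpace_coe
  set M := L.topologicalClosure
  have hM : M ≤ (upperSingularSpace T t)ᗮ :=
    Submodule.topologicalClosure_minimal _ hortho (Submodule.isClosed_orthogonal _)
  -- The residual is orthogonal to small eigenspaces by projection, and to large ones because `x`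
  -- and its projection both are. By the spectral theorem it vanishes, so `x ∈ M`.
  have h0 : x - M.starProjection x ∈
      (⨆ μ, Module.End.eigenspace (gram T : E →ₗ[ℂ] E) μ)ᗮ := by
    rw [← Submodule.iInf_orthogonal, Submodule.mem_iInf]
    intro μ
    rcases lt_or_ge μ.re (t ^ 2) with h | h
    · refine Submodule.orthogonal_le ?_ (Submodule.sub_starProjection_mem_orthogonal x)
      exact (le_iSup (fun μ : {μ : ℂ // μ.re < t ^ 2} =>
        Module.End.eigenspace (gram T : E →ₗ[ℂ] E) (μ : ℂ)) ⟨μ, h⟩).trans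
        (Submodule.le_topologicalClosure L)
    · refine Submodule.orthogonal_le ?_
        (Submodule.sub_mem _ hx (hM (Submodule.starProjection_apply_mem M x)))
      exact le_iSup (fun μ : {μ : ℂ // t ^ 2 ≤ μ.re} =>
        Module.End.eigenspace (gram T : E →ₗ[ℂ] E) (μ : ℂ)) ⟨μ, h⟩
  rw [ContinuousLinearMap.orthogonalComplement_iSup_eigenspaces_eq_bot
    (gram_isCompactOperator hT) (gram_isSymmetric T), Submodule.mem_bot, sub_eq_zero] at h0
  rw [h0]
  exact hLc _ (Submodule.starProjection_apply_mem M x)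

theorem encard_setOf_le_nonzeroSingularValue {T : E →L[ℂ] F} (hT : IsCompactOperator T) {t : ℝ}
    (ht : 0 < t) : {n : SingularIndex T | t ≤ nonzeroSingularValue T n}.encard =
      Cardinal.toENat (Module.rank ℂ (upperSingularSpace T t)) := by
  let J := {s : ℝ // 0 < s ∧ singularSpace T s ≠ ⊥}
  -- Without this, `finrank` could take its default value `0` and lose singular values.
  have hfin : ∀ s : J, FiniteDimensional ℂ (singularSpace T s) := fun s =>
    ContinuousLinearMap.finite_dimensional_eigenspace (gram_isCompactOperator hT) _
      (pow_ne_zero 2 (Complex.ofReal_ne_zero.2 s.2.1.ne'))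
  have hV : OrthogonalFamily ℂ (fun s : J => singularSpace T s)
      fun s => (singularSpace T s).subtypeₗᵢ := by
    refine (gram_isSymmetric T).orthogonalFamily_eigenspaces.comp
      (f := fun s : J => ((s : ℝ) : ℂ) ^ 2) fun a b hab => Subtype.ext ?_
    have h : (a : ℝ) ^ 2 = (b : ℝ) ^ 2 := Complex.ofReal_injective (by simpa using hab)
    exact (pow_left_inj₀ a.2.1.le b.2.1.le two_ne_zero).1 h
  let b : SingularIndex T → E :=
    fun n => (stdOrthonormalBasis ℂ (singularSpace T n.1) n.2 : E)
  have hb : Orthonormal ℂ b := hV.orthonormal_sigma_orthonormal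
    (v_family := fun s => stdOrthonormalBasis ℂ (singularSpace T s))
    fun s => (stdOrthonormalBasis ℂ (singularSpace T s)).orthonormal
  suffices h : Submodule.span ℂ (b '' {n | t ≤ nonzeroSingularValue T n}) =
      upperSingularSpace T t by
    rw [← h]
    exact (toENat_rank_span_set (hb.linearIndependent.linearIndepOn _)).symm
  apply le_antisymm
  · rw [Submodule.span_le]
    rintro _ ⟨n, hn, rfl⟩
    have hn' : t ≤ (n.1 : ℝ) := hn
    have h2 : t ^ 2 ≤ (((n.1 : ℝ) : ℂ) ^ 2).re := by
      rw [← Complex.ofReal_pow, Complex.ofReal_re]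
      gcongr
    exact (le_iSup (fun μ : {μ : ℂ // t ^ 2 ≤ μ.re} =>
        Module.End.eigenspace (gram T : E →ₗ[ℂ] E) (μ : ℂ)) ⟨_, h2⟩)
        (stdOrthonormalBasis ℂ (singularSpace T n.1) n.2).2
  · refine iSup_le fun ⟨μ, hμ⟩ => ?_
    by_cases hbot : Module.End.eigenspace (gram T : E →ₗ[ℂ] E) μ = ⊥
    · exact hbot.le.trans bot_le
    have hreal : ((μ.re : ℝ) : ℂ) = μ :=
      Complex.conj_eq_iff_re.1 ((gram_isSymmetric T).conj_eigenvalue_eq_self hbot)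
    have hpos : 0 < μ.re := (by positivity : 0 < t ^ 2).trans_le hμ
    have hs : ((√μ.re : ℝ) : ℂ) ^ 2 = μ := by
      rw [← Complex.ofReal_pow, Real.sq_sqrt hpos.le, hreal]
    have heq : singularSpace T √μ.re = Module.End.eigenspace (gram T : E →ₗ[ℂ] E) μ := by
      rw [singularSpace, hs]
    let s : J := ⟨√μ.re, Real.sqrt_pos.2 hpos, heq ▸ hbot⟩
    change Module.End.eigenspace (gram T : E →ₗ[ℂ] E) μ ≤ _
    rw [← heq]
    intro x hx
    have hx2 := congrArg (Subtype.val)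
      ((stdOrthonormalBasis ℂ (singularSpace T s)).sum_repr ⟨x, hx⟩)
    change _ = x at hx2
    rw [← hx2, Submodule.coe_sum]
    refine Submodule.sum_mem _ fun i _ => ?_
    rw [Submodule.coe_smul]
    refine Submodule.smul_mem _ _ (Submodule.subset_span ⟨⟨s, i⟩, ?_, rfl⟩)
    exact Real.le_sqrt_of_sq_le hμ

variable {E' F' : Type*} [NormedAddCommGroup E'] [InnerProductSpace ℂ E'] [CompleteSpace E']
  [NormedAddCommGroup F'] [InnerProductSpace ℂ F'] [CompleteSpace F']

theorem nonzeroSingularValue_pos (T : E →L[ℂ] F) (n : SingularIndex T) :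
    0 < nonzeroSingularValue T n := n.1.2.1

/-- Min-max by dimension: a larger count on the left would give `x ≠ 0` in the upper space of `A T
B` with `B x` orthogonal to that of `T`, whence `t ‖x‖ ≤ ‖A T B x‖ ≤ (t / c) ‖A‖ ‖B‖ ‖x‖ < t ‖x‖`.
-/
theorem encard_setOf_le_nonzeroSingularValue_comp_le {T : E →L[ℂ] F} (hT : IsCompactOperator T)
    (A : F →L[ℂ] F') (B : E' →L[ℂ] E) {c t : ℝ} (hc : ‖A‖ * ‖B‖ < c) (ht : 0 < t) :
    {n : SingularIndex (A ∘L T ∘L B) | t ≤ nonzeroSingularValue (A ∘L T ∘L B) n}.encard ≤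
      {n : SingularIndex T | t / c ≤ nonzeroSingularValue T n}.encard := by
  have hc0 : 0 < c := (by positivity : 0 ≤ ‖A‖ * ‖B‖).trans_lt hc
  have htc : 0 < t / c := div_pos ht hc0
  have hATB : IsCompactOperator (A ∘L T ∘L B) := hT.clm_comp_clm A B
  have := finiteDimensional_upperSingularSpace hT htc
  rw [encard_setOf_le_nonzeroSingularValue hATB ht, encard_setOf_le_nonzeroSingularValue hT htc]
  let φ : upperSingularSpace (A ∘L T ∘L B) t →ₗ[ℂ] upperSingularSpace T (t / c) :=
    ((upperSingularSpace T (t / c)).orthogonalProjectionOnto : E →ₗ[ℂ] _) ∘ₗ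
      (B : E' →ₗ[ℂ] E) ∘ₗ (upperSingularSpace (A ∘L T ∘L B) t).subtype
  have hφ : Function.Injective φ := by
    refine (injective_iff_map_eq_zero φ).2 fun x hx => ?_
    have hBx : B x ∈ (upperSingularSpace T (t / c))ᗮ :=
      Submodule.orthogonalProjectionOnto_eq_zero_iff.1 hx
    have h1 := norm_apply_le_of_mem_upperSingularSpace_orthogonal hT htc hBx
    have h2 : t * ‖(x : E')‖ ≤ ‖A (T (B x))‖ := le_norm_apply_of_mem_upperSingularSpace _ x.2
    have h3 : t * ‖(x : E')‖ ≤ t / c * (‖A‖ * ‖B‖) * ‖(x : E')‖ :=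
      calc t * ‖(x : E')‖ ≤ ‖A‖ * ‖T (B x)‖ := h2.trans (A.le_opNorm _)
        _ ≤ ‖A‖ * (t / c * (‖B‖ * ‖(x : E')‖)) := by
          gcongr
          refine h1.trans ?_
          gcongr
          exact B.le_opNorm _
        _ = _ := by ring
    have h4 : t / c * (‖A‖ * ‖B‖) < t := by
      rw [div_mul_eq_mul_div, div_lt_iff₀ hc0]
      gcongr
    by_contra hne
    have h5 : 0 < ‖(x : E')‖ := norm_pos_iff.2 fun h => hne (Subtype.ext h)
    exact absurd (le_of_mul_le_mul_right h3 h5) (not_le.2 h4)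
  have h := Cardinal.toENat.monotone' (LinearMap.lift_rank_le_of_injective φ hφ)
  simpa using h

/-- The Schatten classes have the ideal property. -/
theorem IsSchatten.comp {p : ℝ} (hp : 0 < p) {T : E →L[ℂ] F} (hT : IsSchatten p T)
    (A : F →L[ℂ] F') (B : E' →L[ℂ] E) : IsSchatten p (A ∘L T ∘L B) :=
  -- The `+ 1` makes the bound strict and keeps `c` positive when `A` or `B` is zero.
  ⟨hT.1.clm_comp_clm A B, summable_rpow_of_encard_le (c := ‖A‖ * ‖B‖ + 1) hp
    (by positivity) (fun n => (nonzeroSingularValue_pos _ n).le)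
    (fun n => (nonzeroSingularValue_pos _ n).le)
    (fun _ => encard_setOf_le_nonzeroSingularValue_comp_le hT.1 A B (lt_add_one _)) hT.2⟩

end Schatten

/-! ### Invertibility of the frame operator and recovery of `O` -/

section Frame

variable {I : Type*} {H : Type*} [NormedAddCommGroup H] [InnerProductSpace ℂ H]
  [CompleteSpace H]

theorem WeightedSubspaces.hasSum_norm_sq_analysis (W : WeightedSubspaces I H) (hW : W.IsBessel)
    (f : H) : HasSum (fun i => W.weight i ^ 2 * ‖(W.space i).starProjection f‖ ^ 2)
      (‖W.analysis hW f‖ ^ 2) := by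
  have h := lp.hasSum_norm (p := 2) (by norm_num) (W.analysis hW f)
  simp only [ENNReal.toReal_ofNat, Real.rpow_ofNat] at h
  refine h.congr_fun fun i => ?_
  rw [analysis_apply, norm_smul, mul_pow, Complex.norm_real, Real.norm_eq_abs, sq_abs]
  rfl

theorem WeightedSubspaces.inner_frameOperator_self (W : WeightedSubspaces I H) (hW : W.IsBessel)
    (f : H) : ⟪W.frameOperator hW f, f⟫_ℂ = (‖W.analysis hW f‖ : ℂ) ^ 2 := by
  change ⟪W.synthesis hW (W.analysis hW f), f⟫_ℂ = _
  rw [← ContinuousLinearMap.adjoint_inner_right]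
  exact inner_self_eq_norm_sq_to_K _

theorem WeightedSubspaces.frameOperator_nonneg (W : WeightedSubspaces I H) (hW : W.IsBessel) :
    0 ≤ W.frameOperator hW :=
  ContinuousLinearMap.nonneg_iff_isPositive _ |>.2
    (ContinuousLinearMap.isPositive_self_comp_adjoint _)

/-- The lower frame bound is coercivity: `⟪S_W f, f⟫ = ‖T_W^* f‖ ^ 2 ≥ A ‖f‖ ^ 2`. -/
theorem WeightedSubspaces.IsFusionFrame.isUnit_frameOperator {W : WeightedSubspaces I H}
    (hW : W.IsFusionFrame) : IsUnit (W.frameOperator hW.isBessel) := by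
  obtain ⟨A, B, hA, -, -, hAf⟩ := id hW
  refine ContinuousLinearMap.isUnit_of_forall_le_norm_inner_map _ (c := ⟨A, hA.le⟩) hA fun f => ?_
  rw [W.inner_frameOperator_self, norm_pow, Complex.norm_real, norm_norm,
    ← (W.hasSum_norm_sq_analysis hW.isBessel f).tsum_eq, mul_comm]
  exact hAf f

theorem WeightedSubspaces.IsFusionFrame.isUnit_frameOperatorInvSqrt {W : WeightedSubspaces I H}
    (hW : W.IsFusionFrame) : IsUnit (W.frameOperatorInvSqrt hW) :=
  hW.isUnit_frameOperator.cfcRpow _ (W.frameOperator_nonneg _)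

theorem matrixRep_eq_comp (W V : WeightedSubspaces I H) (hW : W.IsBessel) (hV : V.IsBessel)
    (O : H →L[ℂ] H) :
    matrixRep W V hW hV O = W.analysis hW ∘L O ∘L V.synthesis hV := by
  rw [matrixRep, tensorOp, WeightedSubspaces.analysis.eq_1 V, ContinuousLinearMap.adjoint_adjoint]

/-- For fusion frames, `O` is recovered from `M^{(W,V)}(O)`. -/
theorem exists_comp_matrixRep_eq (W V : WeightedSubspaces I H) (hW : W.IsFusionFrame)
    (hV : V.IsFusionFrame) : ∃ (A : W.DirectSum →L[ℂ] H) (B : H →L[ℂ] V.DirectSum),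
      ∀ O : H →L[ℂ] H, A ∘L matrixRep W V hW.isBessel hV.isBessel O ∘L B = O := by
  obtain ⟨a, ha⟩ := hW.isUnit_frameOperator.exists_left_inv
  obtain ⟨b, hb⟩ := hV.isUnit_frameOperator.exists_right_inv
  refine ⟨a ∘L W.synthesis hW.isBessel, V.analysis hV.isBessel ∘L b, fun O => ?_⟩
  rw [matrixRep_eq_comp]
  calc (a ∘L W.synthesis hW.isBessel) ∘L
        (W.analysis hW.isBessel ∘L O ∘L V.synthesis hV.isBessel) ∘L (V.analysis hV.isBessel ∘L b)
      = (a * W.frameOperator hW.isBessel) * O * (V.frameOperator hV.isBessel * b) := rfl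
    _ = O := by rw [ha, hb, one_mul, mul_one]

theorem exists_comp_tensorOp_eq {S T : H →L[ℂ] H} (hS : IsUnit S) (hT : IsUnit T) :
    ∃ A B : H →L[ℂ] H, ∀ O : H →L[ℂ] H, A ∘L tensorOp S T O ∘L B = O := by
  obtain ⟨a, ha⟩ := hS.exists_left_inv
  obtain ⟨b, hb⟩ := hT.star.exists_right_inv
  refine ⟨a, b, fun O => ?_⟩
  calc a ∘L tensorOp S T O ∘L b = (a * S) * O * (star T * b) := rfl
    _ = O := by rw [ha, hb, one_mul, mul_one]

end Frame

end

theorem mainTheorem11 {I : Type*} {H : Type*} [NormedAddCommGroup H] [InnerProductSpace ℂ H]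
    [CompleteSpace H] (W V : WeightedSubspaces I H) (O : H →L[ℂ] H) (p : ℝ) (hp : 0 < p) :
    (∀ (hW : W.IsBessel) (hV : V.IsBessel),
      (IsCompactOperator O → IsCompactOperator (matrixRep W V hW hV O)) ∧
      (IsSchatten p O → IsSchatten p (matrixRep W V hW hV O))) ∧
    (∀ (hW : W.IsFusionFrame) (hV : V.IsFusionFrame),
      (IsCompactOperator O ↔ IsCompactOperator (matrixRep W V hW.isBessel hV.isBessel O)) ∧
      (IsCompactOperator O ↔ IsCompactOperator (matrixRepTensor W V hW hV O)) ∧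
      (IsSchatten p O ↔ IsSchatten p (matrixRep W V hW.isBessel hV.isBessel O)) ∧
      (IsSchatten p O ↔ IsSchatten p (matrixRepTensor W V hW hV O))) := by
  have compact (hW : W.IsBessel) (hV : V.IsBessel) (Q : H →L[ℂ] H) (hQ : IsCompactOperator Q) :
      IsCompactOperator (matrixRep W V hW hV Q) := by
    rw [matrixRep_eq_comp]
    exact hQ.clm_comp_clm _ _
  have schatten (hW : W.IsBessel) (hV : V.IsBessel) (Q : H →L[ℂ] H) (hQ : IsSchatten p Q) :
      IsSchatten p (matrixRep W V hW hV Q) := by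
    rw [matrixRep_eq_comp]
    exact hQ.comp hp _ _
  refine ⟨fun hW hV => ⟨compact hW hV O, schatten hW hV O⟩, fun hW hV => ?_⟩
  obtain ⟨A, B, hAB⟩ := exists_comp_matrixRep_eq W V hW hV
  obtain ⟨C, D, hCD⟩ :=
    exists_comp_tensorOp_eq hW.isUnit_frameOperatorInvSqrt hV.isUnit_frameOperatorInvSqrt
  have compact' (Q : H →L[ℂ] H)
      (hQ : IsCompactOperator (matrixRep W V hW.isBessel hV.isBessel Q)) : IsCompactOperator Q := by
    rw [← hAB Q]
    exact hQ.clm_comp_clm _ _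
  have schatten' (Q : H →L[ℂ] H)
      (hQ : IsSchatten p (matrixRep W V hW.isBessel hV.isBessel Q)) : IsSchatten p Q := by
    rw [← hAB Q]
    exact hQ.comp hp _ _
  refine ⟨⟨compact _ _ O, compact' O⟩, ⟨fun h => compact _ _ _ (h.clm_comp_clm _ _),
    fun h => ?_⟩, ⟨schatten _ _ O, schatten' O⟩, ⟨fun h => schatten _ _ _ (h.comp hp _ _),
    fun h => ?_⟩⟩
  -- `compact'` strips off `M`, leaving the operator sandwiched between the inverse square roots,
  -- which `C` and `D` undo.
  · rw [← hCD O]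
    exact (compact' _ h).clm_comp_clm _ _
  · rw [← hCD O]
    exact (schatten' _ h).comp hp _ _
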